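/- Let $N\ge 0$. A chiral boson edge theory with $\mathbb{Z}_2$ symmetry consists of the following data. (a) A symmetric integer $N\times N$ matrix $K$ with $\det K\neq 0$, an integer $N\times N$ matrix $W$ with $W^2=1$ and $W^TKW=K$, and a vector $\chi\in\mathbb{R}^N$. (b) Fields $\Theta_1,\dots,\Theta_N$ on the line with commutation relations $[\Theta_i(x),\Theta_j(y)]=\pi i\,(K_{ij}\,\mathrm{sgn}(y-x)+X_{ij})$, where $\mathrm{sgn}(0)=0$ and $X$ is a real antisymmetric matrix such that, for $x\ne y$, the operators $e^{i\Theta_i(x)}$ and $e^{i\Theta_j(y)}$ anticommute if $K_{ii}$ and $K_{jj}$ are both odd, and commute otherwise. The operators considered are $z\,e^{i\sum_x f(x)^T\Theta(x)}$ with $|z|=1$ and $f:\mathbb{R}\to\mathbb{Z}^N$ of finite support, multiplied by the rule $e^{iA}e^{iB}=e^{i(A+B)}e^{-[A,B]/2}$. (c) A symmetry action $O\mapsto S^{-1}OS$, that is, an automorphism of the group of these operators that fixes all phases, squares to the identity, and satisfies $$S^{-1}e^{i\Theta_j(x)}S=e^{i\sum_k W_{kj}\Theta_k(x)}\,e^{i\pi\chi_j}\qquad\text{for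 all } j \text{ and } x .$$ The theory is *bosonic* if all diagonal entries of $K$ are even, and *fermionic* if at least one of them is odd. It is an *SPT* edge theory if $|\det K|=1$ and $\mathrm{sig}(K)=0$, where $\mathrm{sig}$ denotes the number of positive minus the number of negative eigenvalues. Let $\chi_+\in\mathbb{R}^N$ be any vector such that $W^T\chi_+=\chi_+$ and $$S^{-1}e^{i\Lambda^T\Theta(x)}S=e^{i\Lambda^T\Theta(x)}\,e^{i\pi\Lambda^T\chi_+}\qquad\text{for all } x \text{ and all } \Lambda\in\mathbb{Z}^N \text{ with } W\Lambda=\Lambda .$$ Define $$\nu\equiv\tfrac12\,\chi_+^TK^{-1}\chi_++\tfrac14\,\mathrm{sig}\big(K(1-W)\big)\pmod 2 .$$ Then for every SPT edge theory and every such $\chi_+$: if the theory is bosonic, $\nu$ is an integer (modulo $2$); if it is fermionic, $\nu$ is an integer multiple of $1/4$ (modulo $2$). -/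

import Mathlib

noncomputable section

namespace ChiralBoson

/-- The coefficient of `π i` in the commutator `[∑_x f(x)ᵀ Θ(x), ∑_y g(y)ᵀ Θ(y)]`, where
`[Θ_i(x), Θ_j(y)] = π i (K_ij sgn(y - x) + X_ij)`, for finitely supported families `f`, `g` of
integer vectors indexed by points of the line. -/
def commForm {N : ℕ} (K : Matrix (Fin N) (Fin N) ℤ) (X : Matrix (Fin N) (Fin N) ℝ)
    (f g : ℝ →₀ (Fin N → ℤ)) : ℝ :=
  f.sum fun x a => g.sum fun y b =>
    ∑ i, ∑ j, (a i : ℝ) * ((K i j : ℝ) * Real.sign (y - x) + X i j) * (b j : ℝ)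

theorem commForm_add_left {N : ℕ} (K : Matrix (Fin N) (Fin N) ℤ) (X : Matrix (Fin N) (Fin N) ℝ)
    (f f' g : ℝ →₀ (Fin N → ℤ)) :
    commForm K X (f + f') g = commForm K X f g + commForm K X f' g := by
  unfold commForm
  rw [Finsupp.sum_add_index']
  · intro x
    simp
  · intro x a b
    rw [← Finsupp.sum_add]
    refine Finsupp.sum_congr fun y _ => ?_
    simp only [← Finset.sum_add_distrib]
    refine Finset.sum_congr rfl fun i _ => Finset.sum_congr rfl fun j _ => ?_
    push_cast [Pi.add_apply]
    ring

theorem commForm_add_right {N : ℕ} (K : Matrix (Fin N) (Fin N) ℤ) (X : Matrix (Fin N) (Fin N) ℝ)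
    (f g g' : ℝ →₀ (Fin N → ℤ)) :
    commForm K X f (g + g') = commForm K X f g + commForm K X f g' := by
  unfold commForm
  rw [← Finsupp.sum_add]
  refine Finsupp.sum_congr fun x _ => ?_
  rw [Finsupp.sum_add_index']
  · intro y
    simp
  · intro y b b'
    simp only [← Finset.sum_add_distrib]
    refine Finset.sum_congr rfl fun i _ => Finset.sum_congr rfl fun j _ => ?_
    push_cast [Pi.add_apply]
    ring

/-- The operator `z · exp(i ∑_x f(x)ᵀ Θ(x))`, with `z` a phase and `f` a finitely supported family
of integer vectors. These are all phases times products of the operators `exp(i Θ_j(x))` and their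
inverses. -/
@[ext]
structure VertexOp {N : ℕ} (K : Matrix (Fin N) (Fin N) ℤ) (X : Matrix (Fin N) (Fin N) ℝ) where
  phase : Circle
  label : ℝ →₀ (Fin N → ℤ)

namespace VertexOp

variable {N : ℕ} {K : Matrix (Fin N) (Fin N) ℤ} {X : Matrix (Fin N) (Fin N) ℝ}

/-- The product is given by the Baker-Campbell-Hausdorff formula
`exp(iA) exp(iB) = exp(i(A + B)) exp(-[A, B]/2)`. -/
instance : Mul (VertexOp K X) :=
  ⟨fun u v => ⟨u.phase * v.phase *
    Circle.exp (-(Real.pi / 2 * commForm K X u.label v.label)), u.label + v.label⟩⟩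

instance : One (VertexOp K X) := ⟨⟨1, 0⟩⟩

instance : Inv (VertexOp K X) :=
  ⟨fun u => ⟨u.phase⁻¹ * Circle.exp (Real.pi / 2 * commForm K X (-u.label) u.label), -u.label⟩⟩

theorem mul_def (u v : VertexOp K X) : u * v = ⟨u.phase * v.phase *
    Circle.exp (-(Real.pi / 2 * commForm K X u.label v.label)), u.label + v.label⟩ := rfl

theorem one_def : (1 : VertexOp K X) = ⟨1, 0⟩ := rfl

theorem inv_def (u : VertexOp K X) : u⁻¹ =
    ⟨u.phase⁻¹ * Circle.exp (Real.pi / 2 * commForm K X (-u.label) u.label), -u.label⟩ := rfl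

instance : Group (VertexOp K X) :=
  Group.ofLeftAxioms
    (by
      intro u v w
      simp only [mul_def, commForm_add_left, commForm_add_right, add_assoc]
      congr 1
      simp only [mul_add, neg_add, Circle.exp_add]
      simp only [mul_assoc, mul_comm, mul_left_comm])
    (by
      intro u
      simp [mul_def, one_def, commForm])
    (by
      intro u
      simp only [mul_def, one_def, inv_def, neg_add_cancel, Circle.exp_neg]
      congr 1
      rw [mul_right_comm]
      simp)

/-- The scalar operator `z`. -/
def scalar (K : Matrix (Fin N) (Fin N) ℤ) (X : Matrix (Fin N) (Fin N) ℝ) (z : Circle) :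
    VertexOp K X := ⟨z, 0⟩

/-- The local operator `exp(i Λᵀ Θ(x))`. -/
def vertex (K : Matrix (Fin N) (Fin N) ℤ) (X : Matrix (Fin N) (Fin N) ℝ) (Λ : Fin N → ℤ) (x : ℝ) :
    VertexOp K X := ⟨1, Finsupp.single x Λ⟩

end VertexOp

open VertexOp

/-- A chiral boson edge theory with a `ℤ₂` symmetry, given by its data `(K, W, χ)`, together with
the antisymmetric matrix `X` that fixes the equal-point commutators of the fields, and the action
`S` of the symmetry, `O ↦ S⁻¹ O S`, on the operators. -/
structure Z2EdgeTheory (N : ℕ) where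
  K : Matrix (Fin N) (Fin N) ℤ
  W : Matrix (Fin N) (Fin N) ℤ
  χ : Fin N → ℝ
  K_symm : K.IsSymm
  K_nondeg : K.det ≠ 0
  W_sq : W * W = 1
  W_K : W.transpose * K * W = K
  X : Matrix (Fin N) (Fin N) ℝ
  X_antisymm : X.transpose = -X
  /-- At distinct points, two electron operators anticommute if both are fermionic, and commute
  otherwise. -/
  statistics : ∀ (i j : Fin N) (x y : ℝ), x ≠ y →
    vertex K X (Pi.single i 1) x * vertex K X (Pi.single j 1) y =
      scalar K X (if Odd (K i i) ∧ Odd (K j j) then (-1 : Circle) else 1) *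
        (vertex K X (Pi.single j 1) y * vertex K X (Pi.single i 1) x)
  /-- The map `O ↦ S⁻¹ O S`. -/
  S : VertexOp K X ≃* VertexOp K X
  S_scalar : ∀ z : Circle, S (scalar K X z) = scalar K X z
  S_electron : ∀ (j : Fin N) (x : ℝ), S (vertex K X (Pi.single j 1) x) =
    vertex K X (fun k => W k j) x * scalar K X (Circle.exp (Real.pi * χ j))
  S_sq : ∀ O : VertexOp K X, S (S O) = O

/-- The signature of a real symmetric matrix: the number of positive minus the number of negative
squares in a diagonalization of its quadratic form, that is, the number of positive minus the
number of negative eigenvalues. -/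
def sig {N : ℕ} (M : Matrix (Fin N) (Fin N) ℝ) : ℤ :=
  (sigPos M.toQuadraticForm' : ℤ) - (sigNeg M.toQuadraticForm' : ℤ)

namespace Z2EdgeTheory

variable {N : ℕ}

/-- The matrix `K` with real entries. -/
def KR (E : Z2EdgeTheory N) : Matrix (Fin N) (Fin N) ℝ := E.K.map (Int.cast : ℤ → ℝ)

/-- The matrix `W` with real entries. -/
def WR (E : Z2EdgeTheory N) : Matrix (Fin N) (Fin N) ℝ := E.W.map (Int.cast : ℤ → ℝ)

def IsBosonic (E : Z2EdgeTheory N) : Prop := ∀ i, Even (E.K i i)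

def IsFermionic (E : Z2EdgeTheory N) : Prop := ∃ i, Odd (E.K i i)

/-- The edge theory of a symmetry-protected topological phase. -/
def IsSPT (E : Z2EdgeTheory N) : Prop := |E.K.det| = 1 ∧ sig E.KR = 0

/-- `c` is an admissible choice of the auxiliary vector `χ₊`. -/
structure IsChiPlus (E : Z2EdgeTheory N) (c : Fin N → ℝ) : Prop where
  action : ∀ Λ : Fin N → ℤ, E.W.mulVec Λ = Λ → ∀ x : ℝ,
    E.S (vertex E.K E.X Λ x) =
      vertex E.K E.X Λ x * scalar E.K E.X (Circle.exp (Real.pi * ∑ i, (Λ i : ℝ) * c i))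
  invariant : E.WR.transpose.mulVec c = c

/-- The index `ν = ½ χ₊ᵀ K⁻¹ χ₊ + ¼ sig(K(1 - W))`, computed with the choice `c` of `χ₊`, as an
element of `ℝ / 2ℤ`. -/
def nu (E : Z2EdgeTheory N) (c : Fin N → ℝ) : AddCircle (2 : ℝ) :=
  ((1 / 2 * (c ⬝ᵥ E.KR⁻¹.mulVec c) + 1 / 4 * (sig (E.KR * (1 - E.WR)) : ℝ) : ℝ) :
    AddCircle (2 : ℝ))

end Z2EdgeTheory

end ChiralBoson

end

/-!
The symmetry action turns `2 χ₊` into lattice data. Since `S` exchanges the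
operators of `Λ` and `W Λ` with inverse phases, the phase of their product, which is
`exp(π i (Λ + W Λ)ᵀ χ₊)`, equals their commutator at one point (`exp_chiPlus`). That commutator is
governed by `X`, which the statistics force to be integral with parity `K_ij + K_ii K_jj`
(`exists_int_X`). Hence `2 χ₊ = K t` with `t` integral, `W t = t`, and
`tᵀ K Λ ≡ Λᵀ K Λ + Λᵀ K W Λ (mod 2)` for all `Λ` (`exists_characteristic`), so that
`ν = (tᵀ K t + 2 sig(K(1 - W))) / 8`.

Taking `Λ = t` shows that `tᵀ K t` is even, which is the fermionic case. In the bosonic case the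
term `Λᵀ K Λ` is even and `t` is a characteristic vector of the unimodular form `K W`. By van der
Blij's lemma (`characteristic_sq_modEq`), `tᵀ K t = tᵀ K W t ≡ sig(K W) (mod 8)`. Diagonalizing `K`
in an orthogonal basis of eigenvectors of `W` gives `sig K = sig(K W) + 2 sig(K(1 - W))`, and `sig K = 0`,
so `tᵀ K t + 2 sig(K(1 - W))` is divisible by `8`.

Van der Blij's lemma is proved by evaluating a Gauss sum in two ways. Let `v_i` be an integral
orthogonal family of full rank, doubled so that its norms `a_i` and its pairings with `t` are even.
It spans a sublattice `M`, and the sum of `exp(π i x²)` runs over `M* / M = ∏ ℤ / a_i`. As a product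
of one-dimensional quadratic Gauss sums it has phase `exp(π i sig / 4)`; their values
(`quadratic_gaussSum`) come from the behaviour of the Jacobi theta function at the cusp `1 / a`. On
the other hand, recentre the sum at `t / 2`, which lies in `M*`. Translation by a vector of the
unimodular lattice then multiplies each term by a character, as `t` is characteristic. Averaging
over these translations leaves the lattice points only, each contributing `exp(π i t² / 4)`.
-/

/-! ### Quadratic Gauss sums -/

section GaussSum
open Complex Filter Topology
open scoped Real

/-- At the cusp `i∞`, only the constant term of the theta series survives. -/
theorem tendsto_jacobiTheta₂_atTop (x y : ℝ) :
    Tendsto (fun T : ℝ => jacobiTheta₂ x (y + I * T)) atTop (𝓝 1) := by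
  have key : Tendsto (fun T : ℝ => ∑' n : ℤ, jacobiTheta₂_term n x (y + I * T)) atTop
      (𝓝 (∑' n : ℤ, if n = 0 then (1 : ℂ) else 0)) := by
    refine tendsto_tsum_of_dominated_convergence
      (bound := fun n : ℤ => ‖jacobiTheta₂_term n 0 I‖) ?_ ?_ ?_
    · exact ((summable_jacobiTheta₂_term_iff 0 I).2 (by simp)).norm
    · intro n
      by_cases hn : n = 0
      · simp [hn, jacobiTheta₂_term]
      · rw [if_neg hn, tendsto_zero_iff_norm_tendsto_zero]
        simp only [norm_jacobiTheta₂_term]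
        refine Real.tendsto_exp_atBot.comp ?_
        have hn' : (0 : ℝ) < π * (n : ℝ) ^ 2 := by positivity
        have := (tendsto_id (α := ℝ) (x := atTop)).const_mul_atTop hn'
        refine (tendsto_neg_atTop_atBot.comp this).congr fun T => ?_
        simp
    · filter_upwards [eventually_ge_atTop 1] with T hT n
      rw [norm_jacobiTheta₂_term, norm_jacobiTheta₂_term]
      simp only [add_im, ofReal_im, mul_im, I_re, I_im, ofReal_re, zero_im]
      apply Real.exp_le_exp.2
      have : 0 ≤ π * (n : ℝ) ^ 2 := by positivity
      nlinarith
  simpa [jacobiTheta₂] using key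

theorem jacobiTheta₂_add_two_mul (z τ : ℂ) (m : ℕ) :
    jacobiTheta₂ z (τ + 2 * m) = jacobiTheta₂ z τ := by
  induction m with
  | zero => simp
  | succ m ih => rw [← ih, ← jacobiTheta₂_add_right z (τ + 2 * m)]; push_cast; ring_nf

/-- Poisson summation on each residue class modulo `a`, near the rational point `1 / a`. -/
theorem jacobiTheta₂_near_inv {a : ℕ} (ha : 0 < a) (heven : Even a) {T : ℝ} (hT : 0 < T) :
    jacobiTheta₂ 0 (1 / a + I / (a ^ 2 * T)) = (T : ℂ) ^ (1 / 2 : ℂ) *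
      ∑ r : Fin a, cexp (π * I * (r : ℂ) ^ 2 / a) * jacobiTheta₂ ((-(r / a) : ℝ) : ℂ) (I * T) := by
  have : NeZero a := ⟨ha.ne'⟩
  have ha' : (a : ℂ) ≠ 0 := by exact_mod_cast ha.ne'
  have hT' : (T : ℂ) ≠ 0 := by exact_mod_cast hT.ne'
  have him : 0 < (1 / a + I / (a ^ 2 * T) : ℂ).im := by
    have : (1 / a + I / (a ^ 2 * T) : ℂ) = ((1 / a : ℝ) : ℂ) + ((1 / (a ^ 2 * T) : ℝ) : ℂ) * I := by
      push_cast; ring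
    rw [this, add_im, ofReal_im, im_ofReal_mul, I_im]
    have : (0 : ℝ) < a := by exact_mod_cast ha
    positivity
  have hs := (summable_jacobiTheta₂_term_iff 0 _).2 him
  have hs' := (Int.divModEquiv a).symm.summable_iff.2 hs
  rw [jacobiTheta₂, ← (Int.divModEquiv a).symm.tsum_eq, ← (Equiv.prodComm _ _).tsum_eq,
    Summable.tsum_prod, tsum_fintype, Finset.mul_sum]
  swap
  · exact (Equiv.prodComm _ _).summable_iff.2 hs'
  refine Finset.sum_congr rfl fun r _ => ?_
  have h := Complex.tsum_exp_neg_quadratic (a := T) (by simpa using hT) (-I * (r / a))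
  have h2 : jacobiTheta₂ ((-(r / a) : ℝ) : ℂ) (I * T) =
      ∑' n : ℤ, cexp (-π * T * n ^ 2 + 2 * π * (-I * (r / a)) * n) := by
    rw [jacobiTheta₂]
    refine tsum_congr fun n => ?_
    rw [jacobiTheta₂_term]
    congr 1
    push_cast
    linear_combination (π * n ^ 2 * T : ℂ) * I_mul_I
  have hTc : (T : ℂ) ^ (1 / 2 : ℂ) ≠ 0 := by simp [cpow_eq_zero_iff, hT']
  rw [h2, h, mul_left_comm, ← mul_assoc ((T : ℂ) ^ (1 / 2 : ℂ)), mul_one_div_cancel hTc, one_mul,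
    ← tsum_mul_left]
  refine tsum_congr fun j => ?_
  obtain ⟨m, hm⟩ := heven
  have hm' : (a : ℂ) = m + m := by exact_mod_cast hm
  rw [jacobiTheta₂_term, ← Complex.exp_add, Complex.exp_eq_exp_iff_exists_int]
  refine ⟨m * j ^ 2 + j * r, ?_⟩
  simp only [Equiv.prodComm_apply, Prod.swap_prod_mk, Int.divModEquiv_symm_apply]
  push_cast
  field_simp
  rw [I_sq]
  linear_combination (I * j ^ 2 * a ^ 2 * T : ℂ) * hm' + (j * a + r : ℂ) ^ 2 * I_mul_I

theorem ofReal_mul_cpow {r : ℝ} (hr : 0 < r) {z : ℂ} (hz : z ≠ 0) (w : ℂ) :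
    ((r : ℂ) * z) ^ w = (r : ℂ) ^ w * z ^ w := by
  have hr' : (r : ℂ) ≠ 0 := by exact_mod_cast hr.ne'
  rw [cpow_def_of_ne_zero (mul_ne_zero hr' hz), cpow_def_of_ne_zero hr', cpow_def_of_ne_zero hz,
    log_ofReal_mul hr hz, ofReal_log hr.le, add_mul, Complex.exp_add]

/-- The quadratic Gauss sum of even modulus `a`, including its sign: compare the limits as `T → ∞`
of the theta function at `-1/a + iT` and at its image `1/a + i/(a²T)` under the modular group. -/
theorem quadratic_gaussSum {a : ℕ} (ha : 0 < a) (heven : Even a) :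
    ∑ r : Fin a, cexp (π * I * (r : ℂ) ^ 2 / a) = Real.sqrt a * cexp (π * I / 4) := by
  have ha' : (a : ℂ) ≠ 0 := by exact_mod_cast ha.ne'
  set u : ℝ → ℂ := fun T => 1 + I * (((1 / a : ℝ) : ℂ) * ((T⁻¹ : ℝ) : ℂ)) with hu
  have hu_lim : Tendsto u atTop (𝓝 1) := by
    have : Tendsto (fun T : ℝ => ((T⁻¹ : ℝ) : ℂ)) atTop (𝓝 ((0 : ℝ) : ℂ)) :=
      (continuous_ofReal.tendsto 0).comp tendsto_inv_atTop_zero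
    simpa [hu] using ((this.const_mul (((1 / a : ℝ) : ℂ))).const_mul I).const_add 1
  have hu_ne : ∀ T, u T ≠ 0 := by
    intro T h
    have := congrArg re h
    simp [hu] at this
  -- Two applications of `τ ↦ -1/τ`, separated by a translation by `a`, carry `-1/a + iT` to the
  -- point `1/a + i/(a²T)`.
  have key : ∀ T : ℝ, 0 < T → jacobiTheta₂ 0 (((-1 / a : ℝ) : ℂ) + I * T) =
      1 / (u T) ^ (1 / 2 : ℂ) * (1 / (a * I / u T) ^ (1 / 2 : ℂ)) *
        ∑ r : Fin a, cexp (π * I * (r : ℂ) ^ 2 / a) *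
          jacobiTheta₂ ((-(r / a) : ℝ) : ℂ) (I * T) := by
    intro T hT
    have hT' : (T : ℂ) ≠ 0 := by exact_mod_cast hT.ne'
    have hTc : (T : ℂ) ^ (1 / 2 : ℂ) ≠ 0 := by simp [cpow_eq_zero_iff, hT']
    have hs : (((-1 / a : ℝ) : ℂ) + I * T) = I * (T * u T) := by
      simp only [hu]
      push_cast
      field_simp
      linear_combination -I_mul_I
    have e1 : -I * (I * (T * u T)) = T * u T := by linear_combination (-T * u T : ℂ) * I_mul_I
    have hu0 := hu_ne T
    have e2 : -1 / (I * (T * u T)) = -(a / u T) + 2 * (a / 2) := by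
      rw [neg_add_eq_sub, eq_sub_iff_add_eq]
      field_simp
      simp only [hu]
      push_cast
      field_simp
      linear_combination -I_mul_I
    obtain ⟨m, hm⟩ := heven
    have hm' : (a : ℂ) / 2 = m := by
      rw [hm]; push_cast; ring
    have e3 : -I * -(a / u T) = a * I / u T := by ring
    have e4 : -1 / -(a / u T) = 1 / a + I / (a ^ 2 * T) := by
      simp only [hu]
      push_cast
      field_simp
    rw [hs, jacobiTheta₂_functional_equation, e1, e2, hm', zero_div, jacobiTheta₂_add_two_mul,
      jacobiTheta₂_functional_equation 0 (-(a / u T)), e3, zero_div, e4,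
      jacobiTheta₂_near_inv ha ⟨m, hm⟩ hT, ofReal_mul_cpow hT hu0]
    simp only [ne_eq, OfNat.ofNat_ne_zero, not_false_eq_true, zero_pow, mul_zero, zero_div,
      Complex.exp_zero, mul_one]
    have hup : u T ^ (1 / 2 : ℂ) ≠ 0 := by simp [cpow_eq_zero_iff, hu0]
    field_simp
  have hslit : (a * I : ℂ) / 1 ∈ slitPlane := by
    right
    simpa using ha.ne'
  have lim1 : Tendsto (fun T : ℝ => jacobiTheta₂ 0 (((-1 / a : ℝ) : ℂ) + I * T)) atTop (𝓝 1) := by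
    simpa using tendsto_jacobiTheta₂_atTop 0 (-1 / a)
  have lim2 : Tendsto (fun T : ℝ => 1 / (u T) ^ (1 / 2 : ℂ) * (1 / (a * I / u T) ^ (1 / 2 : ℂ)) *
        ∑ r : Fin a, cexp (π * I * (r : ℂ) ^ 2 / a) *
          jacobiTheta₂ ((-(r / a) : ℝ) : ℂ) (I * T)) atTop
      (𝓝 (1 / (1 : ℂ) ^ (1 / 2 : ℂ) * (1 / (a * I / 1) ^ (1 / 2 : ℂ)) *
        ∑ r : Fin a, cexp (π * I * (r : ℂ) ^ 2 / a) * 1)) := by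
    refine ((Tendsto.div tendsto_const_nhds
      (hu_lim.cpow tendsto_const_nhds (by simp)) (by simp)).mul
      (Tendsto.div tendsto_const_nhds
        ((Tendsto.div tendsto_const_nhds hu_lim one_ne_zero).cpow tendsto_const_nhds hslit) ?_)).mul
      (tendsto_finsetSum _ fun r _ => tendsto_const_nhds.mul ?_)
    · simp [cpow_eq_zero_iff, ha']
    · simpa using tendsto_jacobiTheta₂_atTop (-(r / a)) 0
  have heq := tendsto_nhds_unique
    (lim1.congr' ((eventually_gt_atTop 0).mono fun T hT => key T hT)) lim2
  have hroot : (a * I : ℂ) ^ (1 / 2 : ℂ) = Real.sqrt a * cexp (π * I / 4) := by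
    have h1 : (a : ℂ) = ((a : ℝ) : ℂ) := by simp
    rw [h1, ofReal_mul_cpow (by exact_mod_cast ha) I_ne_zero, Real.sqrt_eq_rpow,
      ofReal_cpow (by positivity), cpow_def_of_ne_zero I_ne_zero, log_I]
    push_cast
    congr 2
    ring
  have hne : (a * I : ℂ) ^ (1 / 2 : ℂ) ≠ 0 := by simp [cpow_eq_zero_iff, ha']
  simp only [one_cpow, div_one, one_mul, mul_one] at heq
  rw [← hroot]
  rw [one_div_mul_eq_div, eq_div_iff hne, one_mul] at heq
  exact heq.symm
end GaussSum

/-! ### Van der Blij's lemma -/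

section VanDerBlij
open Complex Matrix
open scoped Real

theorem cexp_two_pi_mul_I_eq_one_iff (x : ℂ) : cexp (2 * π * I * x) = 1 ↔ ∃ n : ℤ, x = n := by
  rw [Complex.exp_eq_one_iff]
  refine exists_congr fun n => ?_
  rw [mul_comm (n : ℂ), mul_right_inj' two_pi_I_ne_zero]

/-- The quadratic phase `exp(π i k² / a)` on the residues modulo an even integer `a` of either sign,
evaluated on the least nonnegative representative; evenness of `a` makes this choice immaterial. -/
noncomputable def quadPhase (a : ℤ) (k : ZMod a.natAbs) : ℂ :=
  cexp (π * I * (k.val : ℂ) ^ 2 / a)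

theorem quadPhase_intCast {a : ℤ} (ha : a ≠ 0) (heven : Even a) (m : ℤ) :
    quadPhase a (m : ZMod a.natAbs) = cexp (π * I * (m : ℂ) ^ 2 / a) := by
  have : NeZero a.natAbs := ⟨by simpa using ha⟩
  have hv : (((m : ZMod a.natAbs).val : ℤ) : ZMod a.natAbs) = (m : ZMod a.natAbs) := by simp
  obtain ⟨c, hc⟩ : a ∣ m - ((m : ZMod a.natAbs).val : ℤ) := by
    rw [← Int.natAbs_dvd]
    exact (ZMod.intCast_eq_intCast_iff_dvd_sub _ _ _).1 hv
  obtain ⟨b, hb⟩ := heven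
  have ha' : (a : ℂ) ≠ 0 := by exact_mod_cast ha
  set v : ℤ := ((m : ZMod a.natAbs).val : ℤ) with hv
  have hm : (m : ℂ) = v + a * c := by
    have : m = v + a * c := by linarith
    exact_mod_cast this
  have hb' : (a : ℂ) = b + b := by exact_mod_cast hb
  have hvc : ((m : ZMod a.natAbs).val : ℂ) = v := by simp [hv]
  rw [quadPhase, hvc, Complex.exp_eq_exp_iff_exists_int]
  refine ⟨-(b * c ^ 2 + v * c), ?_⟩
  rw [hm]
  push_cast
  field_simp
  linear_combination (-c ^ 2 * a : ℂ) * hb'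

theorem sum_quadPhase {a : ℤ} (ha : a ≠ 0) (heven : Even a) [Fintype (ZMod a.natAbs)] :
    ∑ k : ZMod a.natAbs, quadPhase a k = Real.sqrt a.natAbs * cexp (π * I * a.sign / 4) := by
  have hpos : 0 < a.natAbs := by simpa using ha
  have he : Even a.natAbs := by simpa using heven
  have h := quadratic_gaussSum hpos he
  have hz : ∑ k : ZMod a.natAbs, quadPhase a k =
      ∑ r : Fin a.natAbs, cexp (π * I * (r : ℂ) ^ 2 / a) := by
    unfold quadPhase
    generalize hn : a.natAbs = n at *
    obtain _ | n := n
    · omega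
    · exact Fintype.sum_equiv (show ZMod (n + 1) ≃ Fin (n + 1) from Equiv.refl _)
        (fun k : ZMod (n + 1) => cexp (π * I * (k.val : ℂ) ^ 2 / a))
        (fun r : Fin (n + 1) => cexp (π * I * (r : ℂ) ^ 2 / a)) fun r => rfl
  rw [hz]
  rcases lt_or_gt_of_ne ha with hlt | hgt
  · have ha2 : (a : ℂ) = -(a.natAbs : ℂ) := by
      have := congrArg (Int.cast : ℤ → ℂ) (show a = -(a.natAbs : ℤ) by omega)
      rwa [Int.cast_neg, Int.cast_natCast] at this
    have h2 := congrArg (starRingEnd ℂ) h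
    rw [map_sum, map_mul, conj_ofReal, ← Complex.exp_conj] at h2
    rw [Int.sign_eq_neg_one_of_neg hlt]
    convert h2 using 2
    · rw [← Complex.exp_conj, ha2]
      simp only [map_div₀, map_mul, conj_ofReal, conj_I, map_pow, map_natCast]
      congr 1
      field_simp
    · congr 1
      simp only [map_div₀, map_mul, conj_ofReal, conj_I, map_ofNat]
      push_cast
      ring
  · have ha2 : (a : ℂ) = (a.natAbs : ℂ) := by
      have := congrArg (Int.cast : ℤ → ℂ) (show a = (a.natAbs : ℤ) by omega)
      rwa [Int.cast_natCast] at this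
    rw [ha2, h, Int.sign_eq_one_of_pos hgt]
    simp

/-- Orthogonality of the characters of a cyclic group of order `m`. -/
theorem sum_cexp_eq_zero {m : ℕ} {x : ℂ} (hx : ¬ ∃ n : ℤ, x = n) (hmx : ∃ n : ℤ, x * m = n) :
    ∑ l : Fin m, cexp (2 * π * I * (x * l)) = 0 := by
  have h1 : cexp (2 * π * I * x) ≠ 1 := fun h => hx ((cexp_two_pi_mul_I_eq_one_iff x).1 h)
  have h2 : ∀ l : ℕ, cexp (2 * π * I * (x * l)) = cexp (2 * π * I * x) ^ l := by
    intro l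
    rw [← Complex.exp_nat_mul]
    congr 1
    ring
  simp only [h2]
  rw [Fin.sum_univ_eq_sum_range (fun l => cexp (2 * π * I * x) ^ l), geom_sum_eq h1, ← h2,
    (cexp_two_pi_mul_I_eq_one_iff _).2 hmx]
  simp

/-- The congruence, for an orthogonal family `B` whose norms `a` are even and on which the
characteristic vector `t` takes even values `2 β`. -/
theorem characteristic_sq_modEq_aux {ι : Type*} [Fintype ι] [DecidableEq ι]
    {F D B : Matrix ι ι ℤ} (hF : F.IsSymm) (hFD : F * D = 1) {t a β : ι → ℤ}
    (ht : ∀ l, Even (l ⬝ᵥ F *ᵥ l + t ⬝ᵥ F *ᵥ l)) (ha : ∀ i, a i ≠ 0) (hae : ∀ i, Even (a i))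
    (hB : Bᵀ * F * B = diagonal a) (hβ : Bᵀ *ᵥ (F *ᵥ t) = 2 • β) :
    (8 : ℤ) ∣ ∑ i, (a i).sign - t ⬝ᵥ F *ᵥ t := by
  have : ∀ i, NeZero (a i).natAbs := fun i => ⟨by simpa using ha i⟩
  have ha' : ∀ i, (a i : ℂ) ≠ 0 := fun i => by exact_mod_cast ha i
  set Bc : Matrix ι ι ℂ := B.map (Int.cast : ℤ → ℂ) with hBc
  set Fc : Matrix ι ι ℂ := F.map (Int.cast : ℤ → ℂ) with hFc
  have hdiag : Bcᵀ * Fc * Bc = diagonal fun i => (a i : ℂ) := by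
    have := congrArg (fun M : Matrix ι ι ℤ => M.map (Int.castRingHom ℂ)) hB
    simp only [Matrix.map_mul] at this
    rw [diagonal_map (map_zero _)] at this
    exact this
  have hleft : diagonal (fun i => (a i : ℂ)⁻¹) * (Bcᵀ * Fc) * Bc = 1 := by
    rw [Matrix.mul_assoc, hdiag, diagonal_mul_diagonal, ← diagonal_one]
    exact congrArg diagonal (funext fun i => inv_mul_cancel₀ (ha' i))
  have hright := mul_eq_one_comm.1 hleft
  have hcast : ∀ q i, (((Bᵀ *ᵥ (F *ᵥ q)) i : ℤ) : ℂ) =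
      ((Bc.transpose * Fc) *ᵥ (fun j => (q j : ℂ))) i := by
    intro q i
    rw [mulVec_mulVec]
    simp only [mulVec, dotProduct, Matrix.mul_apply, transpose_apply, Bc, Fc, map_apply]
    push_cast
    rfl
  have hβc : ∀ i, (((Bᵀ *ᵥ (F *ᵥ t)) i : ℤ) : ℂ) = 2 * β i := by
    intro i
    rw [hβ]
    simp
  -- The inverse Gram matrix is `B diag(1/a) Bᵀ`.
  have hinv : ∀ p q : ι → ℤ, ∑ i, (((Bᵀ *ᵥ (F *ᵥ p)) i : ℤ) : ℂ) * ((Bᵀ *ᵥ (F *ᵥ q)) i : ℤ) / a i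
      = ((p ⬝ᵥ F *ᵥ q : ℤ) : ℂ) := by
    intro p q
    have h1 : (fun j => (p j : ℂ)) ⬝ᵥ Fc *ᵥ (fun j => (q j : ℂ)) =
        ((p ⬝ᵥ F *ᵥ q : ℤ) : ℂ) := by
      simp [mulVec, dotProduct, hFc]
    have h2 : Fcᵀ = Fc := by rw [hFc, ← transpose_map, hF.eq]
    have h3 : (Bcᵀ * Fc)ᵀ = Fc * Bc := by rw [transpose_mul, transpose_transpose, h2]
    rw [← h1]
    simp only [hcast]
    calc _ = ((Bcᵀ * Fc) *ᵥ fun j => (p j : ℂ)) ⬝ᵥ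
          (diagonal (fun i => (a i : ℂ)⁻¹) *ᵥ ((Bcᵀ * Fc) *ᵥ fun j => (q j : ℂ))) := by
          simp only [dotProduct, mulVec_diagonal]
          exact Finset.sum_congr rfl fun i _ => by ring
      _ = (fun j => (p j : ℂ)) ⬝ᵥ
          (Fc * (Bc * (diagonal (fun i => (a i : ℂ)⁻¹) * (Bcᵀ * Fc)))) *ᵥ fun j => (q j : ℂ) := by
          rw [mulVec_mulVec, dotProduct_comm, ← dotProduct_transpose_mulVec, h3, mulVec_mulVec,
            Matrix.mul_assoc]
      _ = _ := by rw [hright, Matrix.mul_one]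
  -- The point of the dual lattice with coordinates `K`.
  set x : (ι → ℤ) → ι → ℂ := fun K j => ∑ i, (B j i : ℂ) * K i / a i with hx
  have hxK : ∀ (K q : ι → ℤ), ∑ i, (K i : ℂ) * ((Bᵀ *ᵥ q) i : ℤ) / a i = ∑ j, x K j * q j := by
    intro K q
    simp only [hx, mulVec, dotProduct, transpose_apply, Finset.sum_mul]
    rw [Finset.sum_comm]
    refine Finset.sum_congr rfl fun i _ => ?_
    push_cast
    rw [Finset.mul_sum, Finset.sum_div]
    exact Finset.sum_congr rfl fun j _ => by ring
  have hxint : ∀ K z : ι → ℤ, (∀ j, x K j = z j) → K = Bᵀ *ᵥ (F *ᵥ z) := by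
    intro K z hz
    have h1 : (fun j => (z j : ℂ)) =
        Bc *ᵥ (diagonal (fun i => (a i : ℂ)⁻¹) *ᵥ fun i => (K i : ℂ)) := by
      funext j
      have hd : (diagonal (fun i => (a i : ℂ)⁻¹) *ᵥ fun i => (K i : ℂ)) =
          fun i => (a i : ℂ)⁻¹ * K i := funext fun i => mulVec_diagonal _ _ i
      rw [← hz j, hd]
      simp only [hx, mulVec, dotProduct, hBc, map_apply]
      exact Finset.sum_congr rfl fun i _ => by ring
    funext i
    have h2 := hcast z i
    rw [h1, mulVec_mulVec _ (Bcᵀ * Fc) Bc, hdiag, mulVec_mulVec _ (diagonal _) (diagonal _),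
      diagonal_mul_diagonal] at h2
    simp only [mulVec_diagonal, mul_inv_cancel₀ (ha' i), one_mul] at h2
    exact_mod_cast h2.symm
  have hFD' : ∀ q, F *ᵥ (D *ᵥ q) = q := fun q => by rw [mulVec_mulVec, hFD, one_mulVec]
  -- `m` clears the denominators of the dual lattice, hence bounds the box of translations below.
  set m : ℕ := ∏ i, (a i).natAbs with hm
  have hmx : ∀ K j, ∃ n : ℤ, x K j * m = n := by
    intro K j
    have : ∀ i, ∃ n : ℤ, (m : ℂ) / a i = n := by
      intro i
      obtain ⟨c, hc⟩ : a i ∣ (m : ℤ) := by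
        rw [← Int.natAbs_dvd, Int.natCast_dvd_natCast]
        exact Finset.dvd_prod_of_mem _ (Finset.mem_univ i)
      refine ⟨c, ?_⟩
      rw [div_eq_iff (ha' i)]
      have := congrArg (Int.cast : ℤ → ℂ) hc
      rw [Int.cast_natCast] at this
      rw [this]
      push_cast
      ring
    choose n hn using this
    refine ⟨∑ i, B j i * K i * n i, ?_⟩
    push_cast
    simp only [hx, Finset.sum_mul, ← hn]
    exact Finset.sum_congr rfl fun i _ => by ring
  -- The quadratic phase of a lift of a residue class.
  have hphase : ∀ K : ι → ℤ, ∏ i, quadPhase (a i) (K i : ZMod (a i).natAbs) =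
      cexp (π * I * ∑ i, (K i : ℂ) ^ 2 / a i) := by
    intro K
    rw [Finset.mul_sum, Complex.exp_sum]
    exact Finset.prod_congr rfl fun i _ => by
      rw [quadPhase_intCast (ha i) (hae i), mul_div_assoc]
  -- Effect of a translation by a vector of the lattice.
  have hshift : ∀ K q : ι → ℤ,
      ∏ i, quadPhase (a i) ((K i + β i + (Bᵀ *ᵥ q) i : ℤ) : ZMod (a i).natAbs) =
        cexp (π * I * ∑ i, ((K i + β i : ℤ) : ℂ) ^ 2 / a i) *
          ∏ j, cexp (2 * π * I * (x K j * q j)) := by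
    intro K q
    rw [hphase, ← Complex.exp_sum, ← Complex.exp_add, Complex.exp_eq_exp_iff_exists_int]
    obtain ⟨e, he⟩ := ht (D *ᵥ q)
    have h1 := hinv (D *ᵥ q) (D *ᵥ q)
    have h2 := hinv t (D *ᵥ q)
    have h3 := hxK K q
    rw [hFD'] at h1 h2
    simp only [hβc] at h2
    have he' : ((D *ᵥ q ⬝ᵥ q : ℤ) : ℂ) + ((t ⬝ᵥ q : ℤ) : ℂ) = e + e := by
      rw [hFD'] at he
      exact_mod_cast he
    refine ⟨e, ?_⟩
    have h4 : ∑ i, ((K i + β i + (Bᵀ *ᵥ q) i : ℤ) : ℂ) ^ 2 / a i =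
        ∑ i, ((K i + β i : ℤ) : ℂ) ^ 2 / a i + 2 * ∑ j, x K j * q j + (e + e) := by
      rw [← he', ← h1, ← h2, ← h3, Finset.mul_sum, ← Finset.sum_add_distrib,
        ← Finset.sum_add_distrib, ← Finset.sum_add_distrib]
      refine Finset.sum_congr rfl fun i _ => ?_
      push_cast
      ring
    rw [h4, ← Finset.mul_sum]
    ring
  -- At a lattice point the phase is `exp(π i t² / 4)`.
  have hself : ∀ K z : ι → ℤ, (∀ j, x K j = z j) →
      cexp (π * I * ∑ i, ((K i + β i : ℤ) : ℂ) ^ 2 / a i) =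
        cexp (π * I * ((t ⬝ᵥ F *ᵥ t : ℤ) : ℂ) / 4) := by
    intro K z hz
    have hK := hxint K z hz
    rw [Complex.exp_eq_exp_iff_exists_int]
    obtain ⟨e, he⟩ := ht z
    have h1 := hinv z z
    have h2 := hinv t z
    have h3 := hinv t t
    simp only [hβc, ← hK] at h1 h2 h3
    have he' : ((z ⬝ᵥ F *ᵥ z : ℤ) : ℂ) + ((t ⬝ᵥ F *ᵥ z : ℤ) : ℂ) = e + e := by
      exact_mod_cast he
    refine ⟨e, ?_⟩
    have h4 : ∑ i, ((K i + β i : ℤ) : ℂ) ^ 2 / a i =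
        (e + e) + ((t ⬝ᵥ F *ᵥ t : ℤ) : ℂ) / 4 := by
      rw [← he', ← h1, ← h2, ← h3, Finset.sum_div, ← Finset.sum_add_distrib,
        ← Finset.sum_add_distrib]
      refine Finset.sum_congr rfl fun i _ => ?_
      push_cast
      ring
    rw [h4]
    ring
  set S : ℂ := ∑ k : ∀ i, ZMod (a i).natAbs, ∏ i, quadPhase (a i) (k i) with hS
  have hS1 : S = ((∏ i, Real.sqrt (a i).natAbs : ℝ) : ℂ) *
      cexp (π * I * ((∑ i, (a i).sign : ℤ) : ℂ) / 4) := by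
    have : S = ∏ i, ∑ k : ZMod (a i).natAbs, quadPhase (a i) k := by
      rw [Finset.prod_univ_sum, Fintype.piFinset_univ]
    rw [this]
    simp only [sum_quadPhase (ha _) (hae _)]
    rw [Finset.prod_mul_distrib, ← Complex.exp_sum, ofReal_prod]
    congr 2
    push_cast
    rw [Finset.mul_sum, Finset.sum_div]
  have hS2 : ∀ q : ι → ℤ, S = ∑ k : ∀ i, ZMod (a i).natAbs,
      cexp (π * I * ∑ i, ((((k i).val : ℤ) + β i : ℤ) : ℂ) ^ 2 / a i) *
          ∏ j, cexp (2 * π * I * (x (fun i => ((k i).val : ℤ)) j * q j)) := by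
    intro q
    rw [hS, ← Equiv.sum_comp
      (Equiv.addRight (fun i => ((β i + (Bᵀ *ᵥ q) i : ℤ) : ZMod (a i).natAbs)))]
    refine Finset.sum_congr rfl fun k _ => ?_
    rw [← hshift]
    refine Finset.prod_congr rfl fun i _ => ?_
    congr 1
    simp [add_assoc]
  -- Averaging over a box of translations leaves the lattice points only.
  have hS3 : ∃ R : ℝ, 0 ≤ R ∧ ((m ^ Fintype.card ι : ℕ) : ℂ) * S =
      R * cexp (π * I * ((t ⬝ᵥ F *ᵥ t : ℤ) : ℂ) / 4) := by
    have h1 : ((m ^ Fintype.card ι : ℕ) : ℂ) * S = ∑ q : ι → Fin m, S := by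
      simp
    have h2 : ((m ^ Fintype.card ι : ℕ) : ℂ) * S = ∑ k : ∀ i, ZMod (a i).natAbs,
        cexp (π * I * ∑ i, ((((k i).val : ℤ) + β i : ℤ) : ℂ) ^ 2 / a i) *
          ∏ j, ∑ l : Fin m, cexp (2 * π * I * (x (fun i => ((k i).val : ℤ)) j * l)) := by
      rw [h1, Finset.sum_congr rfl fun (q : ι → Fin m) _ => hS2 fun j => ((q j : ℕ) : ℤ),
        Finset.sum_comm]
      refine Finset.sum_congr rfl fun k _ => ?_
      rw [← Finset.mul_sum, Finset.prod_univ_sum, Fintype.piFinset_univ]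
      simp
    have h3 : ∀ k : ∀ i, ZMod (a i).natAbs, ∃ r : ℝ, 0 ≤ r ∧
        cexp (π * I * ∑ i, ((((k i).val : ℤ) + β i : ℤ) : ℂ) ^ 2 / a i) *
          ∏ j, ∑ l : Fin m, cexp (2 * π * I * (x (fun i => ((k i).val : ℤ)) j * l)) =
        r * cexp (π * I * ((t ⬝ᵥ F *ᵥ t : ℤ) : ℂ) / 4) := by
      intro k
      by_cases hk : ∀ j, ∃ z : ℤ, x (fun i => ((k i).val : ℤ)) j = z
      · choose z hz using hk
        refine ⟨(m : ℝ) ^ Fintype.card ι, by positivity, ?_⟩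
        rw [hself _ z hz, mul_comm]
        congr 1
        have : ∀ j, ∑ l : Fin m, cexp (2 * π * I * (x (fun i => ((k i).val : ℤ)) j * l)) = m := by
          intro j
          have : ∀ l : Fin m, cexp (2 * π * I * (x (fun i => ((k i).val : ℤ)) j * l)) = 1 := by
            intro l
            rw [cexp_two_pi_mul_I_eq_one_iff, hz]
            exact ⟨z j * l, by push_cast; rfl⟩
          rw [Finset.sum_congr rfl fun l _ => this l]
          simp
        rw [Finset.prod_congr rfl fun j _ => this j]
        simp
      · push Not at hk
        obtain ⟨j, hj⟩ := hk
        refine ⟨0, le_rfl, ?_⟩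
        rw [Finset.prod_eq_zero (Finset.mem_univ j)
          (sum_cexp_eq_zero (by simpa using hj) (hmx _ j))]
        simp
    choose r hr0 hr using h3
    refine ⟨∑ k, r k, Finset.sum_nonneg fun k _ => hr0 k, ?_⟩
    rw [h2, ofReal_sum, Finset.sum_mul]
    exact Finset.sum_congr rfl fun k _ => hr k
  obtain ⟨R, hR0, hR⟩ := hS3
  have hpos : (0 : ℝ) < (m : ℝ) ^ Fintype.card ι * ∏ i, Real.sqrt (a i).natAbs := by
    have h1 : (0 : ℝ) < m := by
      exact_mod_cast Finset.prod_pos fun i _ => Nat.pos_of_ne_zero (NeZero.ne (a i).natAbs)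
    have h2 : 0 < ∏ i, Real.sqrt (a i).natAbs := Finset.prod_pos fun i _ =>
      Real.sqrt_pos.2 (by exact_mod_cast Nat.pos_of_ne_zero (NeZero.ne (a i).natAbs))
    positivity
  set c : ℝ := (m : ℝ) ^ Fintype.card ι * ∏ i, Real.sqrt (a i).natAbs with hc
  have hR' : (c : ℂ) * cexp (π * I * ((∑ i, (a i).sign : ℤ) : ℂ) / 4) =
      R * cexp (π * I * ((t ⬝ᵥ F *ᵥ t : ℤ) : ℂ) / 4) := by
    rw [← hR, hS1, hc]
    push_cast
    ring
  have hnorm : ∀ n : ℤ, ‖cexp (π * I * (n : ℂ) / 4)‖ = 1 := by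
    intro n
    have : (π * I * (n : ℂ) / 4) = ((π * n / 4 : ℝ) : ℂ) * I := by
      push_cast; ring
    rw [this, norm_exp_ofReal_mul_I]
  have hcR : c = R := by
    have := congrArg norm hR'
    rwa [norm_mul, norm_mul, hnorm, hnorm, mul_one, mul_one, norm_real, norm_real,
      Real.norm_of_nonneg hpos.le, Real.norm_of_nonneg hR0] at this
  rw [← hcR] at hR'
  have hexp := mul_left_cancel₀ (by exact_mod_cast hpos.ne') hR'
  rw [Complex.exp_eq_exp_iff_exists_int] at hexp
  obtain ⟨n, hn⟩ := hexp
  refine ⟨n, ?_⟩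
  have h8 : (((∑ i, (a i).sign : ℤ) : ℂ)) - ((t ⬝ᵥ F *ᵥ t : ℤ) : ℂ) = 8 * n := by
    have hpi : (π * I : ℂ) ≠ 0 := by simp [Real.pi_ne_zero]
    apply mul_left_cancel₀ hpi
    linear_combination 4 * hn
  exact_mod_cast h8

/-- **Van der Blij's lemma**: the norm of a characteristic vector `t` of a unimodular integral form
`F` is congruent modulo `8` to the signature, here read off an integral orthogonal family `B`. -/
theorem characteristic_sq_modEq {ι : Type*} [Fintype ι] [DecidableEq ι]
    {F D B : Matrix ι ι ℤ} (hF : F.IsSymm) (hFD : F * D = 1) {t a : ι → ℤ}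
    (ht : ∀ l, Even (l ⬝ᵥ F *ᵥ l + t ⬝ᵥ F *ᵥ l)) (ha : ∀ i, a i ≠ 0)
    (hB : Bᵀ * F * B = diagonal a) :
    (8 : ℤ) ∣ ∑ i, (a i).sign - t ⬝ᵥ F *ᵥ t := by
  -- Doubling `B` makes the norms, and the pairings with `t`, even.
  have h := characteristic_sq_modEq_aux (B := (2 : ℤ) • B) (a := (4 : ℤ) • a)
    (β := Bᵀ *ᵥ (F *ᵥ t)) hF hFD ht (fun i => by simpa using ha i)
    (fun i => ⟨2 * a i, by simp; ring⟩)
    (by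
      rw [diagonal_smul, ← hB, transpose_smul, Matrix.smul_mul, Matrix.smul_mul, Matrix.mul_smul,
        smul_smul]
      norm_num)
    (by
      rw [transpose_smul, smul_mulVec]
      norm_cast)
  simpa [Int.sign_mul, show Int.sign 4 = 1 from rfl] using h

end VanDerBlij

/-! ### Isometric involutions and signatures -/

section Signature
open Matrix

theorem dotProduct_mulVec_eq_sum {N : ℕ} {R : Type*} [CommRing R] (A : Matrix (Fin N) (Fin N) R)
    (v w : Fin N → R) : v ⬝ᵥ A *ᵥ w = ∑ i, ∑ j, v i * A i j * w j := by
  simp only [dotProduct, mulVec, Finset.mul_sum, mul_assoc]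

/-- A symmetric integral matrix with even diagonal defines an even form. -/
theorem even_dotProduct_mulVec {N : ℕ} {K : Matrix (Fin N) (Fin N) ℤ} (hK : K.IsSymm)
    (hdiag : ∀ i, Even (K i i)) (v : Fin N → ℤ) : Even (v ⬝ᵥ K *ᵥ v) := by
  rw [even_iff_two_dvd]
  apply (ZMod.intCast_zmod_eq_zero_iff_dvd _ 2).1
  rw [dotProduct_mulVec_eq_sum, ← Finset.sum_product', Int.cast_sum]
  refine Finset.sum_involution (fun ij _ => ij.swap) ?_ ?_ (fun _ _ => by simp) (fun _ _ => by simp)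
  · rintro ⟨i, j⟩ -
    have h : ((2 : ℕ) : ZMod 2) = 0 := ZMod.natCast_self 2
    simp only [Prod.swap_prod_mk, hK.apply i j]
    push_cast at h ⊢
    linear_combination (v i * K i j * v j : ZMod 2) * h
  · rintro ⟨i, j⟩ - h hij
    obtain rfl : j = i := congrArg Prod.fst hij
    refine h ((ZMod.intCast_zmod_eq_zero_iff_dvd _ 2).2 ?_)
    exact (((hdiag j).mul_left _).mul_right _).two_dvd

/-- An isometric involution is self-adjoint. -/
theorem transpose_mul_eq_mul_of_isometry {N : ℕ} {K W : Matrix (Fin N) (Fin N) ℤ} (hW : W * W = 1)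
    (hWK : Wᵀ * K * W = K) : Wᵀ * K = K * W := by
  calc Wᵀ * K = Wᵀ * K * (W * W) := by rw [hW, Matrix.mul_one]
    _ = K * W := by rw [← Matrix.mul_assoc, hWK]

/-- Sylvester's law of inertia for a congruence with an integral diagonal matrix. -/
theorem sig_eq_sum_sign {N : ℕ} {M B : Matrix (Fin N) (Fin N) ℝ} (hdet : IsUnit B.det)
    {d : Fin N → ℤ} (h : Bᵀ * M * B = diagonal fun i => (d i : ℝ)) :
    ChiralBoson.sig M = ∑ i, (d i).sign := by
  classical
  have hBB := (isUnit_iff_isUnit_det B).2 hdet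
  have e : M.toQuadraticForm'.Equivalent
      (QuadraticMap.weightedSumSquares ℝ fun i => (d i : ℝ)) := by
    refine ⟨QuadraticMap.IsometryEquiv.symm ⟨toLin'OfInv (nonsing_inv_mul B hdet)
      (mul_nonsing_inv B hdet), fun x => ?_⟩⟩
    have : M.toQuadraticForm' (B *ᵥ x) = x ⬝ᵥ (Bᵀ * M * B) *ᵥ x := by
      simp only [toQuadraticForm', LinearMap.BilinMap.toQuadraticMap_apply, toLinearMap₂'_apply']
      rw [← mulVec_mulVec, ← mulVec_mulVec, dotProduct_transpose_mulVec, dotProduct_comm]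
    rw [h] at this
    simp only [QuadraticMap.weightedSumSquares_apply]
    refine Eq.trans this ?_
    simp only [dotProduct, mulVec_diagonal, smul_eq_mul]
    exact Finset.sum_congr rfl fun i _ => by ring
  rw [ChiralBoson.sig, QuadraticForm.sigPos_of_equiv_weightedSumSquares e,
    QuadraticForm.sigNeg_of_equiv_weightedSumSquares e]
  have h1 : ({i | (0 : ℝ) < d i} : Set (Fin N)).ncard = ∑ i, if 0 < d i then 1 else 0 := by
    rw [← Finset.card_filter, ← Set.ncard_coe_finset]
    congr 1
    ext i
    simp
  have h2 : ({i | (d i : ℝ) < 0} : Set (Fin N)).ncard = ∑ i, if d i < 0 then 1 else 0 := by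
    rw [← Finset.card_filter, ← Set.ncard_coe_finset]
    congr 1
    ext i
    simp
  rw [h1, h2]
  push_cast
  rw [← Finset.sum_sub_distrib]
  refine Finset.sum_congr rfl fun i _ => ?_
  rcases lt_trichotomy (d i) 0 with hi | hi | hi
  · simp [hi, hi.le, Int.sign_eq_neg_one_of_neg hi]
  · simp [hi]
  · simp [hi, hi.le, Int.sign_eq_one_of_pos hi]

/-- An isometric involution of a rational symmetric bilinear form has an orthogonal eigenbasis. -/
theorem exists_orthogonal_eigenbasis {V : Type*} [AddCommGroup V] [Module ℚ V]
    [FiniteDimensional ℚ V] {n : ℕ} (hn : Module.finrank ℚ V = n)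
    {β : LinearMap.BilinForm ℚ V} (hβ : LinearMap.IsSymm β) (w : V →ₗ[ℚ] V)
    (hw : ∀ x, w (w x) = x) (hβw : ∀ x y, β (w x) (w y) = β x y) :
    ∃ (b : Module.Basis (Fin n) ℚ V) (ε : Fin n → ℤ),
      (∀ i, ε i = 1 ∨ ε i = -1) ∧ (∀ i, w (b i) = ε i • b i) ∧
      ∀ i j, i ≠ j → β (b i) (b j) = 0 := by
  let p := LinearMap.ker (w - 1)
  let q := LinearMap.ker (w + 1)
  have hp : ∀ x, x ∈ p ↔ w x = x := fun x => by simp [p, sub_eq_zero]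
  have hq : ∀ x, x ∈ q ↔ w x = -x := fun x => by simp [q, add_eq_zero_iff_eq_neg]
  have hpq : IsCompl p q := by
    constructor
    · rw [Submodule.disjoint_def]
      intro x h1 h2
      rw [hp] at h1
      rw [hq, h1] at h2
      have h3 : (2 : ℚ) • x = 0 := by rw [two_smul]; nth_rewrite 1 [h2]; exact neg_add_cancel x
      exact (smul_eq_zero.1 h3).resolve_left two_ne_zero
    · rw [codisjoint_iff, Submodule.eq_top_iff']
      intro x
      rw [Submodule.mem_sup]
      refine ⟨(2⁻¹ : ℚ) • (x + w x), ?_, (2⁻¹ : ℚ) • (x - w x), ?_, ?_⟩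
      · rw [hp, map_smul, map_add, hw, add_comm]
      · rw [hq, map_smul, map_sub, hw, ← smul_neg, neg_sub]
      · module
  have hcross : ∀ x ∈ p, ∀ y ∈ q, β x y = 0 := by
    intro x hx y hy
    have := hβw x y
    rw [(hp x).1 hx, (hq y).1 hy, map_neg] at this
    linarith
  have : Invertible (2 : ℚ) := invertibleOfNonzero two_ne_zero
  obtain ⟨b₁, hb₁⟩ := LinearMap.BilinForm.exists_orthogonal_basis (B := β.restrict p)
    ⟨fun x y => hβ.eq x y⟩
  obtain ⟨b₂, hb₂⟩ := LinearMap.BilinForm.exists_orthogonal_basis (B := β.restrict q)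
    ⟨fun x y => hβ.eq x y⟩
  let b₀ := (b₁.prod b₂).map (Submodule.prodEquivOfIsCompl p q hpq)
  have e := b₀.indexEquiv (Module.finBasisOfFinrankEq ℚ V hn)
  have hl : ∀ i, b₀ (Sum.inl i) = (b₁ i : V) := fun i => by simp [b₀]
  have hr : ∀ i, b₀ (Sum.inr i) = (b₂ i : V) := fun i => by simp [b₀]
  refine ⟨b₀.reindex e, fun i => Sum.elim (fun _ => 1) (fun _ => -1) (e.symm i), ?_, ?_, ?_⟩
  · intro i
    beta_reduce
    generalize e.symm i = k
    cases k <;> simp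
  · intro i
    rw [Module.Basis.reindex_apply]
    beta_reduce
    generalize e.symm i = k
    cases k with
    | inl i => simpa [hl] using (hp _).1 (b₁ i).2
    | inr i => simpa [hr] using (hq _).1 (b₂ i).2
  · intro i j hij
    rw [Module.Basis.reindex_apply, Module.Basis.reindex_apply]
    have hij' : e.symm i ≠ e.symm j := by simpa using hij
    generalize e.symm i = k at *
    generalize e.symm j = l at *
    rcases k with k | k <;> rcases l with l | l
    · rw [hl, hl]
      exact hb₁ (fun h => hij' (by rw [h]))
    · rw [hl, hr]
      exact hcross _ (b₁ k).2 _ (b₂ l).2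
    · rw [hr, hl, ← hβ.eq]
      exact hcross _ (b₁ l).2 _ (b₂ k).2
    · rw [hr, hr]
      exact hb₂ (fun h => hij' (by rw [h]))

/-- An isometric involution of a nondegenerate integral form has an integral orthogonal family of
eigenvectors of full rank, the columns of `B`. -/
theorem exists_integral_orthogonal_eigenbasis {N : ℕ} {K W : Matrix (Fin N) (Fin N) ℤ}
    (hK : K.IsSymm) (hdet : K.det ≠ 0) (hW : W * W = 1) (hWK : Wᵀ * K * W = K) :
    ∃ (B : Matrix (Fin N) (Fin N) ℤ) (ε a : Fin N → ℤ), B.det ≠ 0 ∧ (∀ i, a i ≠ 0) ∧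
      (∀ i, ε i = 1 ∨ ε i = -1) ∧ W * B = B * diagonal ε ∧ Bᵀ * K * B = diagonal a := by
  let KQ : Matrix (Fin N) (Fin N) ℚ := K.map (Int.castRingHom ℚ)
  let WQ : Matrix (Fin N) (Fin N) ℚ := W.map (Int.castRingHom ℚ)
  have hKQ : KQᵀ = KQ := by
    simp only [KQ]
    rw [← transpose_map, hK.eq]
  have hWQ : WQ * WQ = 1 := by
    simp only [WQ]
    rw [← Matrix.map_mul, hW, Matrix.map_one _ (map_zero _) (map_one _)]
  have hWKQ : WQᵀ * KQ * WQ = KQ := by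
    simp only [WQ, KQ]
    rw [← transpose_map, ← Matrix.map_mul, ← Matrix.map_mul, hWK]
  obtain ⟨b, ε, hε, hb, hortho⟩ := exists_orthogonal_eigenbasis (V := Fin N → ℚ)
    (Module.finrank_fin_fun ℚ) (β := toLinearMap₂' ℚ KQ) ⟨fun x y => by
      simp only [toLinearMap₂'_apply', RingHom.id_apply]
      rw [← dotProduct_transpose_mulVec, hKQ]⟩ (toLin' WQ)
    (fun x => by simp [hWQ]) (fun x y => by
      simp only [toLinearMap₂'_apply', toLin'_apply]
      conv_rhs => rw [← hWKQ]
      rw [← mulVec_mulVec, ← mulVec_mulVec, dotProduct_transpose_mulVec, dotProduct_comm])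
  obtain ⟨⟨n, hn⟩, hint⟩ := IsLocalization.exist_integer_multiples_of_finite
    (nonZeroDivisors ℤ) (fun ij : Fin N × Fin N => b ij.2 ij.1)
  have hn0 : n ≠ 0 := nonZeroDivisors.ne_zero hn
  choose B₀ hB₀ using hint
  let B : Matrix (Fin N) (Fin N) ℤ := fun i j => B₀ (i, j)
  have hB : ∀ i j, (B i j : ℚ) = n * b j i := fun i j => by
    simpa [Submonoid.smul_def] using hB₀ (i, j)
  let BQ : Matrix (Fin N) (Fin N) ℚ := B.map (Int.castRingHom ℚ)
  have hcol : ∀ j, BQ.col j = n • b j := fun j => by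
    ext i
    simp [BQ, hB]
  have hBdet : B.det ≠ 0 := by
    intro h0
    have hli : LinearIndependent ℚ BQ.col := by
      have hsmul : BQ.col = (fun _ : Fin N => Units.mk0 (n : ℚ) (by exact_mod_cast hn0)) • ⇑b := by
        funext j
        rw [hcol]
        ext i
        simp [Units.smul_def]
      rw [hsmul]
      exact b.linearIndependent.units_smul _
    have := (isUnit_iff_isUnit_det BQ).1 (linearIndependent_cols_iff_isUnit.1 hli)
    have h1 : BQ.det = ((B.det : ℤ) : ℚ) := by
      simp only [BQ]
      exact (RingHom.map_det (Int.castRingHom ℚ) B).symm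
    rw [h1, h0] at this
    simp at this
  have hWB : W * B = B * diagonal ε := by
    ext i j
    have h1 := congrFun (hb j) i
    simp only [toLin'_apply, mulVec, dotProduct, WQ, map_apply, Int.coe_castRingHom,
      Pi.smul_apply, zsmul_eq_mul] at h1
    rw [mul_diagonal, Matrix.mul_apply]
    have h2 : ((∑ k, W i k * B k j : ℤ) : ℚ) = ((B i j * ε j : ℤ) : ℚ) := by
      push_cast
      simp only [hB]
      rw [mul_assoc, mul_comm (b j i), ← h1, Finset.mul_sum]
      exact Finset.sum_congr rfl fun k _ => by ring
    exact_mod_cast h2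
  have hdiag : Bᵀ * K * B = diagonal fun i => (Bᵀ * K * B) i i := by
    ext i j
    by_cases hij : i = j
    · simp [hij]
    rw [diagonal_apply_ne _ hij]
    have h1 := hortho i j hij
    simp only [toLinearMap₂'_apply', mulVec, dotProduct, KQ, map_apply, Int.coe_castRingHom] at h1
    have h2 : (((Bᵀ * K * B) i j : ℤ) : ℚ) = 0 := by
      rw [Matrix.mul_assoc]
      simp only [Matrix.mul_apply, transpose_apply]
      push_cast
      simp only [hB]
      rw [← mul_zero ((n : ℚ) * n), ← h1]
      simp only [Finset.mul_sum]
      exact Finset.sum_congr rfl fun k _ => Finset.sum_congr rfl fun l _ => by ring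
    exact_mod_cast h2
  refine ⟨B, ε, fun i => (Bᵀ * K * B) i i, hBdet, fun i h0 => ?_, hε, hWB, hdiag⟩
  have h1 := congrArg det hdiag
  have h2 : ∏ i, (Bᵀ * K * B) i i = 0 := Finset.prod_eq_zero (Finset.mem_univ i) h0
  rw [det_diagonal, h2, det_mul, det_mul,
    det_transpose] at h1
  simp [hBdet, hdet] at h1
/-- A unimodular form `K` of signature zero with an isometric involution `W`: the norm of a
characteristic vector of the twisted form `K W` is governed by the signature of `K` on the
`(-1)`-eigenspace of `W`. -/
theorem characteristic_sq_add_two_mul_sig {N : ℕ} {K W : Matrix (Fin N) (Fin N) ℤ}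
    (hK : K.IsSymm) (hdet : |K.det| = 1) (hW : W * W = 1) (hWK : Wᵀ * K * W = K)
    (hsig : ChiralBoson.sig (K.map (Int.cast : ℤ → ℝ)) = 0) {t : Fin N → ℤ}
    (ht : ∀ l, Even (l ⬝ᵥ (K * W) *ᵥ l + t ⬝ᵥ (K * W) *ᵥ l)) :
    (8 : ℤ) ∣ t ⬝ᵥ (K * W) *ᵥ t + 2 * ChiralBoson.sig
      (K.map (Int.cast : ℤ → ℝ) * (1 - W.map (Int.cast : ℤ → ℝ))) := by
  have hKunit : IsUnit K.det := Int.isUnit_iff_abs_eq.2 hdet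
  have hsymm : (K * W).IsSymm := by
    rw [IsSymm, transpose_mul, hK.eq,
      transpose_mul_eq_mul_of_isometry hW hWK]
  obtain ⟨B, ε, a, hB, ha, hε, hWB, hKB⟩ :=
    exists_integral_orthogonal_eigenbasis hK hKunit.ne_zero hW hWK
  have hKWB : Bᵀ * (K * W) * B = diagonal fun i => a i * ε i := by
    rw [Matrix.mul_assoc, Matrix.mul_assoc, hWB, ← Matrix.mul_assoc, ← Matrix.mul_assoc, hKB,
      diagonal_mul_diagonal]
  have hD : (K * W) * (W * K⁻¹) = 1 := by
    rw [Matrix.mul_assoc, ← Matrix.mul_assoc W, hW, Matrix.one_mul, mul_nonsing_inv K hKunit]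
  have h8 := characteristic_sq_modEq hsymm hD ht (a := fun i => a i * ε i)
    (fun i => mul_ne_zero (ha i) (by rcases hε i with h | h <;> simp [h])) hKWB
  have hBR : IsUnit (B.map (Int.cast : ℤ → ℝ)).det := by
    have : (B.map (Int.cast : ℤ → ℝ)).det = ((B.det : ℤ) : ℝ) :=
      (RingHom.map_det (Int.castRingHom ℝ) B).symm
    rw [this, isUnit_iff_ne_zero]
    exact_mod_cast hB
  have hcast : ∀ (M : Matrix (Fin N) (Fin N) ℤ) (d : Fin N → ℤ), Bᵀ * M * B = diagonal d →
      (B.map (Int.cast : ℤ → ℝ))ᵀ * M.map (Int.cast : ℤ → ℝ) * B.map (Int.cast : ℤ → ℝ) =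
        diagonal fun i => (d i : ℝ) := by
    intro M d h
    have := congrArg (fun M : Matrix (Fin N) (Fin N) ℤ => M.map (Int.castRingHom ℝ)) h
    simp only [Matrix.map_mul] at this
    rw [diagonal_map (map_zero _)] at this
    exact this
  have h1 := sig_eq_sum_sign hBR (hcast K a hKB)
  have hminus : Bᵀ * (K * (1 - W)) * B = diagonal fun i => a i * (1 - ε i) := by
    rw [Matrix.mul_sub, Matrix.mul_one, Matrix.mul_sub, Matrix.sub_mul, hKB, hKWB, diagonal_sub]
    congr 1
    funext i
    ring
  have h2 := sig_eq_sum_sign hBR (hcast _ _ hminus)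
  have hmap : (K * (1 - W)).map (Int.cast : ℤ → ℝ) =
      K.map (Int.cast : ℤ → ℝ) * (1 - W.map (Int.cast : ℤ → ℝ)) := by
    have := (Int.castRingHom ℝ).mapMatrix.map_mul K (1 - W)
    rw [map_sub, map_one] at this
    exact this
  rw [hmap] at h2
  rw [hsig] at h1
  -- `sig K = sig (K W) + 2 sig (K (1 - W))`, eigenvector by eigenvector.
  have hrel : ∑ i, (a i * ε i).sign = ∑ i, (a i).sign - 2 * ∑ i, (a i * (1 - ε i)).sign := by
    rw [Finset.mul_sum, ← Finset.sum_sub_distrib]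
    refine Finset.sum_congr rfl fun i _ => ?_
    rcases hε i with h | h
    · simp [h]
    · rw [h]
      simp only [Int.sign_mul, show Int.sign (-1) = -1 from rfl,
        show Int.sign (1 - -1) = 1 from rfl]
      ring
  rw [hrel, ← h1, ← h2] at h8
  obtain ⟨c, hc⟩ := h8
  exact ⟨-c, by linarith⟩

end Signature

/-! ### Operators of the edge theory -/

namespace ChiralBoson

section EdgeTheory
open Matrix VertexOp

variable {N : ℕ}

theorem commForm_single (K : Matrix (Fin N) (Fin N) ℤ) (X : Matrix (Fin N) (Fin N) ℝ)
    (x y : ℝ) (Λ Λ' : Fin N → ℤ) :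
    commForm K X (Finsupp.single x Λ) (Finsupp.single y Λ') =
      ∑ i, ∑ j, (Λ i : ℝ) * ((K i j : ℝ) * Real.sign (y - x) + X i j) * (Λ' j : ℝ) := by
  rw [commForm, Finsupp.sum_single_index (by simp), Finsupp.sum_single_index (by simp)]

/-- At one point of the line the commutator is given by `X` alone. -/
theorem commForm_single_same (K : Matrix (Fin N) (Fin N) ℤ) (X : Matrix (Fin N) (Fin N) ℝ)
    (x : ℝ) (Λ Λ' : Fin N → ℤ) :
    commForm K X (Finsupp.single x Λ) (Finsupp.single x Λ') =
      (fun i => (Λ i : ℝ)) ⬝ᵥ X *ᵥ fun i => (Λ' i : ℝ) := by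
  rw [commForm_single]
  simp only [sub_self, Real.sign_zero, mul_zero, zero_add, dotProduct, mulVec, Finset.mul_sum,
    mul_assoc]

/-- The statistics of the electron operators make the equal-point commutators integral, with parity
`K_ij + K_ii K_jj`. -/
theorem exists_int_X (E : Z2EdgeTheory N) (i j : Fin N) :
    ∃ m : ℤ, E.X i j = m ∧ Even (m + E.K i j + E.K i i * E.K j j) := by
  have h := congrArg VertexOp.phase (E.statistics i j 0 1 zero_ne_one)
  have hs : Real.sign (-1) = -1 := Real.sign_of_neg (by norm_num)
  have hX : E.X j i = -E.X i j := congrFun (congrFun E.X_antisymm i) j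
  have hK : E.K j i = E.K i j := E.K_symm.apply i j
  simp only [vertex, VertexOp.scalar, VertexOp.mul_def, commForm_single] at h
  simp [Pi.single_apply, commForm, hs, hX, hK] at h
  -- With `u = exp(π i r / 2)` the relation reads `u⁻¹ = ± u`, so that `exp(π i r) = ± 1`.
  set r : ℝ := E.K i j + E.X i j with hr
  have hneg : (Circle.exp (Real.pi / 2 * (-(E.K i j : ℝ) + -E.X i j)))⁻¹ =
      Circle.exp (Real.pi / 2 * r) := by
    rw [← Circle.exp_neg]
    congr 1
    ring
  have hsq : Circle.exp (Real.pi * r) = Circle.exp (Real.pi / 2 * r) *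
      Circle.exp (Real.pi / 2 * r) := by
    rw [← Circle.exp_add]
    congr 1
    ring
  rw [hneg] at h
  by_cases hodd : Odd (E.K i i) ∧ Odd (E.K j j)
  · rw [if_pos hodd, inv_eq_iff_mul_eq_one] at h
    have h1 : Circle.exp (Real.pi * (r + 1)) = 1 := by
      rw [mul_add, mul_one, Circle.exp_add, hsq, ← h]
      ext
      simp
    obtain ⟨n, hn⟩ := Circle.exp_eq_one.1 h1
    have h2 : r = ((2 * n - 1 : ℤ) : ℝ) := by
      have : r + 1 = n * 2 := mul_left_cancel₀ Real.pi_ne_zero (by linarith)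
      push_cast
      linarith
    refine ⟨2 * n - 1 - E.K i j, by push_cast at h2 ⊢; linarith, ?_⟩
    have := hodd.1.mul hodd.2
    have h3 : Odd (2 * n - 1 : ℤ) := ⟨n - 1, by ring⟩
    rw [sub_add_cancel]
    exact h3.add_odd this
  · rw [if_neg hodd, inv_eq_iff_mul_eq_one] at h
    rw [← hsq] at h
    obtain ⟨n, hn⟩ := Circle.exp_eq_one.1 h
    have h2 : r = ((2 * n : ℤ) : ℝ) := by
      have : r = n * 2 := mul_left_cancel₀ Real.pi_ne_zero (by linarith)
      push_cast
      linarith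
    refine ⟨2 * n - E.K i j, by push_cast at h2 ⊢; linarith, ?_⟩
    rw [sub_add_cancel]
    refine (even_two_mul n).add ?_
    rw [not_and_or, Int.not_odd_iff_even, Int.not_odd_iff_even] at hodd
    exact Int.even_mul.2 hodd

/-- The symmetry sends the operator with label `Λ` to a phase times the one with label `W Λ`. -/
theorem exists_S_vertex (E : Z2EdgeTheory N) (x : ℝ) (Λ : Fin N → ℤ) :
    ∃ z : Circle, E.S (vertex E.K E.X Λ x) =
      VertexOp.scalar E.K E.X z * vertex E.K E.X (E.W *ᵥ Λ) x := by
  -- The labels on which the claim holds form a subgroup, which contains the electrons.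
  let H : AddSubgroup (Fin N → ℤ) :=
    { carrier := {Λ | (E.S (vertex E.K E.X Λ x)).label = Finsupp.single x (E.W *ᵥ Λ)}
      zero_mem' := by
        have : vertex E.K E.X 0 x = 1 := by simp [vertex, VertexOp.one_def]
        rw [Set.mem_ofPred_eq, this, map_one]
        simp [VertexOp.one_def]
      add_mem' := by
        intro a b ha hb
        have : vertex E.K E.X (a + b) x = VertexOp.scalar E.K E.X
            (Circle.exp (-(Real.pi / 2 *
              commForm E.K E.X (Finsupp.single x a) (Finsupp.single x b))))⁻¹
            * (vertex E.K E.X a x * vertex E.K E.X b x) := by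
          ext <;> simp [vertex, VertexOp.scalar, VertexOp.mul_def, commForm]
        simp only [Set.mem_ofPred_eq] at ha hb ⊢
        rw [this, map_mul, map_mul, E.S_scalar]
        simp [VertexOp.scalar, VertexOp.mul_def, ha, hb, mulVec_add]
      neg_mem' := by
        intro a ha
        have : vertex E.K E.X (-a) x = VertexOp.scalar E.K E.X
            (Circle.exp (Real.pi / 2 *
              commForm E.K E.X (-Finsupp.single x a) (Finsupp.single x a)))⁻¹
            * (vertex E.K E.X a x)⁻¹ := by
          ext <;> simp [vertex, VertexOp.scalar, VertexOp.mul_def, VertexOp.inv_def, commForm]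
        simp only [Set.mem_ofPred_eq] at ha ⊢
        rw [this, map_mul, map_inv, E.S_scalar]
        simp [VertexOp.scalar, VertexOp.mul_def, VertexOp.inv_def, ha, mulVec_neg] }
  have hsingle : ∀ j, Pi.single j 1 ∈ H := by
    intro j
    show (E.S (vertex E.K E.X (Pi.single j 1) x)).label = _
    rw [E.S_electron]
    have : E.W *ᵥ Pi.single j 1 = fun k => E.W k j := by
      rw [mulVec_single_one]
      rfl
    simp [this, vertex, VertexOp.scalar, VertexOp.mul_def]
  have hmem : Λ ∈ H := by
    rw [pi_eq_sum_univ Λ]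
    refine H.sum_mem fun j _ => H.zsmul_mem ?_ _
    convert hsingle j using 1
    ext i
    simp [Pi.single_apply, eq_comm]
  have hmem' : (E.S (vertex E.K E.X Λ x)).label = Finsupp.single x (E.W *ᵥ Λ) := hmem
  refine ⟨(E.S (vertex E.K E.X Λ x)).phase, ?_⟩
  apply VertexOp.ext
  · simp [vertex, VertexOp.scalar, VertexOp.mul_def, commForm]
  · rw [hmem']
    simp [vertex, VertexOp.scalar, VertexOp.mul_def]

theorem vertex_mul_vertex (K : Matrix (Fin N) (Fin N) ℤ) (X : Matrix (Fin N) (Fin N) ℝ)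
    (x : ℝ) (Λ Λ' : Fin N → ℤ) :
    vertex K X Λ x * vertex K X Λ' x = VertexOp.scalar K X (Circle.exp (-(Real.pi / 2 *
      ((fun i => (Λ i : ℝ)) ⬝ᵥ X *ᵥ fun i => (Λ' i : ℝ))))) * vertex K X (Λ + Λ') x := by
  rw [← commForm_single_same K X x]
  ext <;> simp [vertex, VertexOp.scalar, VertexOp.mul_def, commForm]

theorem scalar_mul_comm (K : Matrix (Fin N) (Fin N) ℤ) (X : Matrix (Fin N) (Fin N) ℝ)
    (z : Circle) (u : VertexOp K X) :
    VertexOp.scalar K X z * u = u * VertexOp.scalar K X z := by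
  ext <;> simp [VertexOp.scalar, VertexOp.mul_def, commForm, mul_comm]

theorem scalar_mul_scalar (K : Matrix (Fin N) (Fin N) ℤ) (X : Matrix (Fin N) (Fin N) ℝ)
    (z w : Circle) :
    VertexOp.scalar K X z * VertexOp.scalar K X w = VertexOp.scalar K X (z * w) := by
  ext <;> simp [VertexOp.scalar, VertexOp.mul_def, commForm]

theorem scalar_injective (K : Matrix (Fin N) (Fin N) ℤ) (X : Matrix (Fin N) (Fin N) ℝ) :
    Function.Injective (VertexOp.scalar K X) := fun _ _ h => congrArg VertexOp.phase h

/-- The operators of `Λ` and of `W Λ` are exchanged by the symmetry, up to inverse phases, so the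
phase of their product is their commutator. -/
theorem exp_chiPlus (E : Z2EdgeTheory N) {c : Fin N → ℝ} (hc : E.IsChiPlus c) (Λ : Fin N → ℤ) :
    Circle.exp (Real.pi * ∑ i, ((Λ + E.W *ᵥ Λ) i : ℝ) * c i) =
      Circle.exp (Real.pi * ((fun i => (Λ i : ℝ)) ⬝ᵥ E.X *ᵥ fun i => ((E.W *ᵥ Λ) i : ℝ))) := by
  obtain ⟨z, hz⟩ := exists_S_vertex E 0 Λ
  have hWW : E.W *ᵥ (E.W *ᵥ Λ) = Λ := by rw [mulVec_mulVec, E.W_sq, one_mulVec]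
  have hz' : E.S (vertex E.K E.X (E.W *ᵥ Λ) 0) =
      VertexOp.scalar E.K E.X z⁻¹ * vertex E.K E.X Λ 0 := by
    have h := E.S_sq (vertex E.K E.X Λ 0)
    rw [hz, map_mul, E.S_scalar] at h
    rw [← h, ← mul_assoc, scalar_mul_scalar, inv_mul_cancel]
    exact (one_mul _).symm
  have hinv : E.W *ᵥ (Λ + E.W *ᵥ Λ) = Λ + E.W *ᵥ Λ := by
    rw [mulVec_add, hWW, add_comm]
  have hact := hc.action _ hinv 0
  set ω : ℝ := (fun i => (Λ i : ℝ)) ⬝ᵥ E.X *ᵥ fun i => ((E.W *ᵥ Λ) i : ℝ) with hω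
  have hω' : (fun i => ((E.W *ᵥ Λ) i : ℝ)) ⬝ᵥ E.X *ᵥ (fun i => (Λ i : ℝ)) = -ω := by
    rw [← dotProduct_transpose_mulVec, E.X_antisymm, neg_mulVec, dotProduct_neg]
  have h1 := vertex_mul_vertex E.K E.X 0 Λ (E.W *ᵥ Λ)
  have h2 := vertex_mul_vertex E.K E.X 0 (E.W *ᵥ Λ) Λ
  rw [hω', add_comm (E.W *ᵥ Λ)] at h2
  have h3 := congrArg E.S h1
  rw [map_mul, map_mul, hz, hz', E.S_scalar, hact, mul_assoc, ← mul_assoc (vertex E.K E.X _ 0),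
    ← scalar_mul_comm, mul_assoc, ← mul_assoc, scalar_mul_scalar, mul_inv_cancel, h2,
    ← scalar_mul_comm, ← mul_assoc, ← mul_assoc, scalar_mul_scalar, scalar_mul_scalar,
    mul_right_cancel_iff] at h3
  have h4 := scalar_injective _ _ h3
  rw [one_mul, ← hω, Circle.exp_neg (Real.pi / 2 * ω), eq_inv_mul_iff_mul_eq] at h4
  rw [← h4, ← Circle.exp_add]
  congr 1
  ring

/-- Twice `χ₊` is the image under `K` of a `W`-invariant integral vector `t`, and pairing with `t`
gives the parity of `Λᵀ K Λ + Λᵀ K W Λ`. Integrality and parity both come from `exp_chiPlus`, as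
`(Λ + W Λ)ᵀ χ₊ = 2 Λᵀ χ₊`. -/
theorem exists_characteristic (E : Z2EdgeTheory N) (hdet : IsUnit E.K.det) {c : Fin N → ℝ}
    (hc : E.IsChiPlus c) : ∃ t : Fin N → ℤ, (∀ i, 2 * c i = ((E.K *ᵥ t) i : ℤ)) ∧
      E.W *ᵥ t = t ∧
      ∀ Λ, Even (Λ ⬝ᵥ E.K *ᵥ Λ + Λ ⬝ᵥ (E.K * E.W) *ᵥ Λ + Λ ⬝ᵥ E.K *ᵥ t) := by
  obtain ⟨Y, hY, hYeven⟩ : ∃ Y : Matrix (Fin N) (Fin N) ℤ, (∀ i j, E.X i j = Y i j) ∧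
      ∀ i j, Even (Y i j + E.K i j + E.K i i * E.K j j) := by
    choose Y hY hYeven using exists_int_X E
    exact ⟨Y, hY, hYeven⟩
  have hXY : ∀ v w : Fin N → ℤ, (fun i => (v i : ℝ)) ⬝ᵥ E.X *ᵥ (fun i => (w i : ℝ)) =
      ((v ⬝ᵥ Y *ᵥ w : ℤ) : ℝ) := by
    intro v w
    rw [dotProduct_mulVec_eq_sum, dotProduct_mulVec_eq_sum]
    push_cast
    simp only [hY]
  have hYself : ∀ v : Fin N → ℤ, v ⬝ᵥ Y *ᵥ v = 0 := by
    intro v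
    have h1 := hXY v v
    have h2 := hXY v v
    rw [← dotProduct_transpose_mulVec, E.X_antisymm, neg_mulVec, dotProduct_neg, h1] at h2
    have h3 : ((v ⬝ᵥ Y *ᵥ v : ℤ) : ℝ) = 0 := by linarith
    exact_mod_cast h3
  -- The parity of the number of fermions in a label.
  set p : (Fin N → ℤ) → ℤ := fun v => ∑ i, E.K i i * v i with hp
  have hpar : ∀ v w : Fin N → ℤ, Even (v ⬝ᵥ Y *ᵥ w +
      v ⬝ᵥ E.K *ᵥ w + p v * p w) := by
    intro v w
    have : v ⬝ᵥ Y *ᵥ w + v ⬝ᵥ E.K *ᵥ w + p v * p w =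
        ∑ i, ∑ j, v i * (Y i j + E.K i j + E.K i i * E.K j j) * w j := by
      rw [dotProduct_mulVec_eq_sum, dotProduct_mulVec_eq_sum, hp]
      simp only [Finset.sum_mul_sum]
      rw [← Finset.sum_add_distrib, ← Finset.sum_add_distrib]
      refine Finset.sum_congr rfl fun i _ => ?_
      rw [← Finset.sum_add_distrib, ← Finset.sum_add_distrib]
      exact Finset.sum_congr rfl fun j _ => by ring
    rw [this]
    exact Finset.even_sum _ fun i _ => Finset.even_sum _ fun j _ =>
      ((hYeven i j).mul_left _).mul_right _
  have hpself : ∀ v, Even (v ⬝ᵥ E.K *ᵥ v + p v) := by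
    intro v
    have := hpar v v
    rw [hYself, zero_add, Int.even_add, Int.even_mul, or_self] at this
    rwa [Int.even_add]
  have hisom : ∀ v, (E.W *ᵥ v) ⬝ᵥ E.K *ᵥ (E.W *ᵥ v) = v ⬝ᵥ E.K *ᵥ v := by
    intro v
    conv_rhs => rw [← E.W_K]
    rw [← mulVec_mulVec, ← mulVec_mulVec, dotProduct_transpose_mulVec, dotProduct_comm]
  have hYW : ∀ Λ, Even (Λ ⬝ᵥ Y *ᵥ (E.W *ᵥ Λ) +
      Λ ⬝ᵥ (E.K * E.W) *ᵥ Λ + Λ ⬝ᵥ E.K *ᵥ Λ) := by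
    intro Λ
    have h1 := hpar Λ (E.W *ᵥ Λ)
    have h2 := hpself Λ
    have h3 := hpself (E.W *ᵥ Λ)
    rw [hisom] at h3
    rw [← mulVec_mulVec]
    rw [Int.even_add] at h2 h3
    rw [Int.even_add, Int.even_add] at h1 ⊢
    rw [Int.even_mul] at h1
    tauto
  have hpair : ∀ Λ : Fin N → ℤ, ∃ n : ℤ, ∑ i, (Λ i : ℝ) * (2 * c i) =
      ((Λ ⬝ᵥ Y *ᵥ (E.W *ᵥ Λ) + 2 * n : ℤ) : ℝ) := by
    intro Λ
    have h := exp_chiPlus E hc Λ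
    rw [hXY] at h
    have hsum : ∑ i, ((Λ + E.W *ᵥ Λ) i : ℝ) * c i = ∑ i, (Λ i : ℝ) * (2 * c i) := by
      have h1 : ∑ i, ((E.W *ᵥ Λ) i : ℝ) * c i = ∑ i, (Λ i : ℝ) * c i := by
        have h2 : (fun i => ((E.W *ᵥ Λ) i : ℝ)) = E.WR *ᵥ fun i => (Λ i : ℝ) := by
          funext i
          simp [mulVec, dotProduct, Z2EdgeTheory.WR]
        calc _ = c ⬝ᵥ (E.WR *ᵥ fun i => (Λ i : ℝ)) := by
              rw [← h2, dotProduct_comm]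
              rfl
          _ = (fun i => (Λ i : ℝ)) ⬝ᵥ E.WRᵀ *ᵥ c := (dotProduct_transpose_mulVec _ _ _).symm
          _ = _ := by
              rw [hc.invariant]
              rfl
      simp only [Pi.add_apply, Int.cast_add, add_mul, Finset.sum_add_distrib, h1]
      rw [← Finset.sum_add_distrib]
      exact Finset.sum_congr rfl fun i _ => by ring
    rw [hsum, ← div_eq_one, ← Circle.exp_sub, Circle.exp_eq_one] at h
    obtain ⟨n, hn⟩ := h
    refine ⟨n, ?_⟩
    push_cast
    apply mul_left_cancel₀ Real.pi_ne_zero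
    linarith
  have hint : ∀ i, ∃ m : ℤ, 2 * c i = m := by
    intro i
    obtain ⟨n, hn⟩ := hpair (Pi.single i 1)
    refine ⟨_, Eq.trans ?_ hn⟩
    simp [Pi.single_apply]
  choose s hs using hint
  have hWs : E.Wᵀ *ᵥ s = s := by
    funext i
    have h := congrFun hc.invariant i
    have h2 : (((E.Wᵀ *ᵥ s) i : ℤ) : ℝ) = ((s i : ℤ) : ℝ) := by
      rw [← hs, ← h]
      simp only [mulVec, dotProduct, Finset.mul_sum, transpose_apply, Z2EdgeTheory.WR, map_apply]
      push_cast
      simp only [← hs]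
      exact Finset.sum_congr rfl fun j _ => by ring
    exact_mod_cast h2
  have hKt : E.K *ᵥ (E.K⁻¹ *ᵥ s) = s := by
    rw [mulVec_mulVec, mul_nonsing_inv _ hdet, one_mulVec]
  have hWK := transpose_mul_eq_mul_of_isometry E.W_sq E.W_K
  refine ⟨E.K⁻¹ *ᵥ s, fun i => by rw [hKt, hs], ?_, fun Λ => ?_⟩
  · have h : E.K *ᵥ (E.W *ᵥ (E.K⁻¹ *ᵥ s)) = s := by
      rw [mulVec_mulVec, ← hWK, ← mulVec_mulVec, hKt, hWs]
    have h2 := congrArg (fun v => E.K⁻¹ *ᵥ v) h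
    simp only [mulVec_mulVec, ← Matrix.mul_assoc, nonsing_inv_mul _ hdet] at h2
    rw [Matrix.one_mul, ← mulVec_mulVec] at h2
    exact h2
  · rw [hKt]
    obtain ⟨n, hn⟩ := hpair Λ
    have h1 : Λ ⬝ᵥ s = Λ ⬝ᵥ Y *ᵥ (E.W *ᵥ Λ) + 2 * n := by
      simp only [hs] at hn
      simp only [dotProduct] at hn ⊢
      exact_mod_cast hn
    obtain ⟨k, hk⟩ := hYW Λ
    exact ⟨k + n, by linarith⟩

/-! ### Quantization of the index -/

/-- The index in terms of the characteristic vector `t`. -/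
theorem nu_eq_of_two_mul_eq (E : Z2EdgeTheory N) (hunit : IsUnit E.K.det) {c : Fin N → ℝ}
    {t : Fin N → ℤ} (hct : ∀ i, 2 * c i = ((E.K *ᵥ t) i : ℤ)) :
    E.nu c = ((((t ⬝ᵥ E.K *ᵥ t + 2 * sig (E.KR * (1 - E.WR)) : ℤ) : ℝ) / 8 : ℝ) :
      AddCircle (2 : ℝ)) := by
  have hquad : c ⬝ᵥ E.KR⁻¹ *ᵥ c = ((t ⬝ᵥ E.K *ᵥ t : ℤ) : ℝ) / 4 := by
    have hKR : E.KR * (E.K⁻¹).map (Int.cast : ℤ → ℝ) = 1 := by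
      have := congrArg (fun M : Matrix (Fin N) (Fin N) ℤ => M.map (Int.castRingHom ℝ))
        (mul_nonsing_inv E.K hunit)
      simp only [Matrix.map_mul] at this
      rw [Matrix.map_one _ (map_zero _) (map_one _)] at this
      exact this
    have hc2 : c = E.KR *ᵥ fun i => (t i : ℝ) / 2 := by
      funext i
      have := hct i
      rw [eq_comm, ← mul_right_inj' (two_ne_zero' ℝ), this]
      simp only [mulVec, dotProduct, Z2EdgeTheory.KR, map_apply, Finset.mul_sum]
      push_cast
      exact Finset.sum_congr rfl fun j _ => by ring
    have hunitR : IsUnit E.KR.det := (isUnit_iff_isUnit_det _).1 (.of_mul_eq_one _ hKR)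
    have hinv : E.KR⁻¹ *ᵥ c = fun i => (t i : ℝ) / 2 := by
      rw [hc2, mulVec_mulVec, nonsing_inv_mul _ hunitR, one_mulVec]
    rw [hinv]
    have : ∀ i, c i = ((E.K *ᵥ t) i : ℤ) / 2 := fun i => by rw [← hct]; ring
    simp only [dotProduct, this]
    push_cast
    rw [Finset.sum_div]
    exact Finset.sum_congr rfl fun i _ => by ring
  rw [Z2EdgeTheory.nu, hquad]
  congr 1
  push_cast
  ring

theorem exists_nu_eq_of_isBosonic (E : Z2EdgeTheory N) (hSPT : E.IsSPT) (hb : E.IsBosonic)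
    {c : Fin N → ℝ} (hc : E.IsChiPlus c) :
    ∃ n : ℤ, E.nu c = ((n : ℝ) : AddCircle (2 : ℝ)) := by
  obtain ⟨hdet, hsig⟩ := hSPT
  have hunit : IsUnit E.K.det := Int.isUnit_iff_abs_eq.2 hdet
  obtain ⟨t, hct, hWt, hchar⟩ := exists_characteristic E hunit hc
  have hKWt : (E.K * E.W) *ᵥ t = E.K *ᵥ t := by rw [← mulVec_mulVec, hWt]
  obtain ⟨n, hn⟩ := characteristic_sq_add_two_mul_sig E.K_symm hdet E.W_sq E.W_K hsig (t := t)
    (fun l => by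
      obtain ⟨k, hk⟩ := hchar l
      obtain ⟨m, hm⟩ := even_dotProduct_mulVec E.K_symm hb l
      have h2 : t ⬝ᵥ (E.K * E.W) *ᵥ l = l ⬝ᵥ E.K *ᵥ t := by
        rw [← hKWt, ← dotProduct_transpose_mulVec, transpose_mul, E.K_symm.eq,
          transpose_mul_eq_mul_of_isometry E.W_sq E.W_K]
      rw [h2]
      exact ⟨k - m, by linarith⟩)
  refine ⟨n, ?_⟩
  rw [hKWt] at hn
  change _ + 2 * sig (E.KR * (1 - E.WR)) = _ at hn
  rw [nu_eq_of_two_mul_eq E hunit hct, hn]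
  congr 1
  push_cast
  ring

/-- As `tᵀ K t` is even, `ν = (tᵀ K t + 2 sig(K(1 - W))) / 8` has denominator at most `4`. -/
theorem exists_nu_eq_div_four (E : Z2EdgeTheory N) (hunit : IsUnit E.K.det)
    {c : Fin N → ℝ} (hc : E.IsChiPlus c) :
    ∃ n : ℤ, E.nu c = (((n : ℝ) / 4 : ℝ) : AddCircle (2 : ℝ)) := by
  obtain ⟨t, hct, hWt, hchar⟩ := exists_characteristic E hunit hc
  -- At `Λ = t` the characteristic property reads `3 tᵀ K t ≡ 0 (mod 2)`.
  have h2 : Even (t ⬝ᵥ E.K *ᵥ t) := by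
    obtain ⟨k, hk⟩ := hchar t
    rw [← mulVec_mulVec, hWt] at hk
    exact ⟨k - t ⬝ᵥ E.K *ᵥ t, by linarith⟩
  obtain ⟨k, hk⟩ := h2
  refine ⟨k + sig (E.KR * (1 - E.WR)), ?_⟩
  rw [nu_eq_of_two_mul_eq E hunit hct, hk]
  congr 1
  push_cast
  ring

end EdgeTheory

end ChiralBoson

theorem mainTheorem6 {N : ℕ} (E : ChiralBoson.Z2EdgeTheory N) (hSPT : E.IsSPT)
    (c : Fin N → ℝ) (hc : E.IsChiPlus c) :
    (E.IsBosonic → ∃ n : ℤ, E.nu c = ((n : ℝ) : AddCircle (2 : ℝ))) ∧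
    (E.IsFermionic → ∃ n : ℤ, E.nu c = (((n : ℝ) / 4 : ℝ) : AddCircle (2 : ℝ))) :=
  ⟨fun hb => ChiralBoson.exists_nu_eq_of_isBosonic E hSPT hb hc,
    fun _ => ChiralBoson.exists_nu_eq_div_four E (Int.isUnit_iff_abs_eq.2 hSPT.1) hc⟩
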